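/- Let $X, Y, Y_1, Y_2$ be (real) Hilbert spaces, let $X_1\subset X$ be a convex subset, and let $L : Y_1\oplus Y_2\to Y$ be a continuous linear surjection. For $i=1,2$ let $F_i : X_1\to 2^{Y_i}$ be a set-valued mapping with convex closed bounded images which is uniformly continuous with modulus $\omega_i:[0,+\infty)\to[0,+\infty)$, that is, $\lim_{t\to+0}\omega_i(t)=0$ and $h(F_i(x),F_i(x'))\le\omega_i(\|x-x'\|)$ for all $x,x'\in X_1$, where $h$ is the Hausdorff distance. Write $(F_1(x),F_2(x))=\{(y_1,y_2)\in Y_1\oplus Y_2 \mid y_1\in F_1(x),\ y_2\in F_2(x)\}$ and suppose that $d=\sup_{x\in X_1}\operatorname{diam}(F_1(x),F_2(x))<+\infty$. Let $f:X_1\to Y$ be Lipschitz continuous with $f(x)\in L(F_1(x),F_2(x))$ for all $x\in X_1$. Then for every $\varepsilon>0$ there exist Lipschitz continuous functions $f_i:X_1\to Y_i$, $i=1,2$, such that $f_i(x)\in F_i(x)+B^{Y_i}_\varepsilon(0)$ and $f(x)=L(f_1(x),f_2(x))$ for all $x\in X_1$, where $B^{Y_i}_\varepsilon(0)=\{y\in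 Y_i\mid \|y\|\le\varepsilon\}$. -/

import Mathlib

open scoped NNReal ENNReal Topology Pointwise

/-- The pair `(A, B)` of two sets, as a subset of the Hilbert direct sum `Y₁ ⊕ Y₂`
(the product with the norm `‖(u, v)‖² = ‖u‖² + ‖v‖²`). -/
def pairSet {Y₁ Y₂ : Type*} (A : Set Y₁) (B : Set Y₂) : Set (WithLp 2 (Y₁ × Y₂)) :=
  {z | z.fst ∈ A ∧ z.snd ∈ B}

/-- The set-valued mapping `F` is uniformly continuous with modulus `ω : [0, ∞) → [0, ∞)`:
`ω t → 0` as `t → 0+`, and the Hausdorff distance of `F x` and `F x'` is at most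
`ω (dist x x')`. The extended Hausdorff distance is used, so that the bound has its
literal meaning for arbitrary sets. -/
def UniformlyContinuousWithModulus {X Y : Type*} [PseudoMetricSpace X] [PseudoMetricSpace Y]
    (F : X → Set Y) (ω : ℝ≥0 → ℝ≥0) : Prop :=
  Filter.Tendsto ω (𝓝[>] 0) (𝓝 0) ∧
    ∀ x x' : X, Metric.hausdorffEDist (F x) (F x') ≤ (ω (nndist x x') : ℝ≥0∞)

/-! Put `F x = pairSet (F₁ x) (F₂ x)` and fatten it by `ρ = ε / 2`, keeping only the points of the
fibre `L y = f x`. These sets are convex, nonempty and of uniformly bounded diameter. Because `ρ >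
0`, they also vary uniformly continuously: a point slightly too far from `F x'` can be pulled back
inside the fibre towards an exact solution in `F x'` (`exists_dist_le_of_fattened_fiber`).

An approximate Chebyshev centre then gives a selection with small oscillation at some scale `δ`
(`exists_selection_of_convex_of_dist_le`). On a `δ`-separated net in a convex domain such a map is
Lipschitz, so Kirszbraun's theorem yields a uniformly close Lipschitz map
(`Convex.exists_lipschitzWith_dist_le`). A bounded linear right inverse of `L` moves that map back
into the fibres at a cost proportional to the approximation error. The two coordinates of the result
are `f₁` and `f₂`. -/

section Kirszbraun

variable {X Y : Type*} [NormedAddCommGroup X] [InnerProductSpace ℝ X]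
  [NormedAddCommGroup Y] [InnerProductSpace ℝ Y]

/-- The variance of a weighted family depends only on mutual distances, so for nonnegative weights
it decreases when these shrink. -/
theorem sum_mul_norm_sq_sub_norm_sum_sq {ι : Type*} [Fintype ι] (w : ι → ℝ)
    (hw : ∑ i, w i = 1) (g : ι → Y) :
    ∑ i, w i * ‖g i‖ ^ 2 - ‖∑ i, w i • g i‖ ^ 2 =
      (∑ i, ∑ j, w i * w j * ‖g i - g j‖ ^ 2) / 2 := by
  have h1 : ‖∑ i, w i • g i‖ ^ 2 = ∑ i, ∑ j, w i * w j * inner ℝ (g i) (g j) := by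
    rw [← real_inner_self_eq_norm_sq, sum_inner]
    refine Finset.sum_congr rfl fun i _ => ?_
    rw [inner_sum]
    refine Finset.sum_congr rfl fun j _ => ?_
    rw [real_inner_smul_left, real_inner_smul_right]; ring
  have h2 : ∀ i, ∑ j, w i * w j * ‖g i - g j‖ ^ 2 =
      w i * ‖g i‖ ^ 2 - 2 * ∑ j, w i * w j * inner ℝ (g i) (g j)
        + w i * ∑ j, w j * ‖g j‖ ^ 2 := by
    intro i
    have : w i * ‖g i‖ ^ 2 = ∑ j, w i * w j * ‖g i‖ ^ 2 := by
      rw [← Finset.sum_mul, ← Finset.mul_sum, hw, mul_one]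
    rw [this, Finset.mul_sum, Finset.mul_sum, ← Finset.sum_sub_distrib, ← Finset.sum_add_distrib]
    refine Finset.sum_congr rfl fun j _ => ?_
    rw [norm_sub_sq_real]; ring
  rw [Finset.sum_congr rfl fun i _ => h2 i, Finset.sum_add_distrib, Finset.sum_sub_distrib,
    ← Finset.mul_sum, ← Finset.sum_mul, hw, h1]
  ring

/-- Lagrange duality: `q w` is the minimum over `c` of `∑ i, w i * (‖c - g i‖ ^ 2 - ‖u i‖ ^ 2)`,
attained at `c = ∑ i, w i • g i`. The variance identity gives `q ≤ 0` on the simplex, and the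
first-order condition at a maximiser shows that its `c` satisfies every constraint. -/
theorem exists_forall_norm_sub_le_of_finite {ι : Type*} [Finite ι] (u : ι → X) (g : ι → Y)
    (h : ∀ i j, ‖g i - g j‖ ≤ ‖u i - u j‖) : ∃ c : Y, ∀ i, ‖c - g i‖ ≤ ‖u i‖ := by
  classical
  cases nonempty_fintype ι
  rcases isEmpty_or_nonempty ι with hι | ⟨⟨i₀⟩⟩
  · exact ⟨0, fun i => hι.elim i⟩
  set a : ι → ℝ := fun i => ‖g i‖ ^ 2 - ‖u i‖ ^ 2 with ha
  set q : (ι → ℝ) → ℝ := fun w => ∑ i, w i * a i - ‖∑ i, w i • g i‖ ^ 2 with hq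
  obtain ⟨w, hwS, hmax⟩ := (isCompact_stdSimplex ℝ ι).exists_isMaxOn
    ⟨_, single_mem_stdSimplex ℝ i₀⟩ (f := q) (by fun_prop)
  have hq0 : q w ≤ 0 := by
    have h1 := sum_mul_norm_sq_sub_norm_sum_sq w hwS.2 g
    have h2 := sum_mul_norm_sq_sub_norm_sum_sq w hwS.2 u
    have h3 : ∑ i, ∑ j, w i * w j * ‖g i - g j‖ ^ 2 ≤ ∑ i, ∑ j, w i * w j * ‖u i - u j‖ ^ 2 := by
      refine Finset.sum_le_sum fun i _ => Finset.sum_le_sum fun j _ => ?_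
      exact mul_le_mul_of_nonneg_left (pow_le_pow_left₀ (norm_nonneg _) (h i j) 2)
        (mul_nonneg (hwS.1 i) (hwS.1 j))
    have h4 : q w = ∑ i, w i * ‖g i‖ ^ 2 - ∑ i, w i * ‖u i‖ ^ 2 - ‖∑ i, w i • g i‖ ^ 2 := by
      simp only [hq, ha, mul_sub, Finset.sum_sub_distrib]
    have h5 := sq_nonneg ‖∑ i, w i • u i‖
    linarith
  refine ⟨∑ i, w i • g i, fun i => ?_⟩
  set c := ∑ i, w i • g i with hc
  set A := ∑ i, w i * a i with hA
  have hqw : q w = A - ‖c‖ ^ 2 := rfl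
  -- Maximality of `q` at `w` along the segment to the vertex `i`, divided by `t`; letting `t` tend
  -- to `0` gives `key0`.
  have key : ∀ t : ℝ, 0 < t → t ≤ 1 →
      a i - A + 2 * ‖c‖ ^ 2 - 2 * inner ℝ c (g i) ≤ t * ‖c - g i‖ ^ 2 := by
    intro t ht ht1
    have hm := hmax (a := (1 - t) • w + t • Pi.single i 1)
      (convex_stdSimplex ℝ ι hwS (single_mem_stdSimplex ℝ i) (by linarith) ht.le (by ring))
    have e1 : ∑ j, ((1 - t) • w + t • Pi.single i 1 : ι → ℝ) j * a j = (1 - t) * A + t * a i := by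
      simp [add_mul, Finset.sum_add_distrib, hA, Finset.mul_sum, mul_assoc, Pi.single_apply]
    have e2 : ∑ j, ((1 - t) • w + t • Pi.single i 1 : ι → ℝ) j • g j = (1 - t) • c + t • g i := by
      simp [add_smul, Finset.sum_add_distrib, hc, Finset.smul_sum, mul_smul, Pi.single_apply]
    have e3 : ‖(1 - t) • c + t • g i‖ ^ 2 =
        (1 - t) ^ 2 * ‖c‖ ^ 2 + 2 * ((1 - t) * t * inner ℝ c (g i)) + t ^ 2 * ‖g i‖ ^ 2 := by
      rw [norm_add_sq_real, norm_smul, norm_smul, real_inner_smul_left, real_inner_smul_right,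
        mul_pow, mul_pow, Real.norm_eq_abs, Real.norm_eq_abs, sq_abs, sq_abs]
      ring
    have hm' : (1 - t) * A + t * a i - ‖(1 - t) • c + t • g i‖ ^ 2 ≤ A - ‖c‖ ^ 2 := by
      have : q ((1 - t) • w + t • Pi.single i 1) ≤ q w := hm
      simpa only [hqw, hq, e1, e2] using this
    rw [e3] at hm'
    rw [norm_sub_sq_real]
    refine le_of_mul_le_mul_left ?_ ht
    nlinarith
  have key0 : a i - A + 2 * ‖c‖ ^ 2 - 2 * inner ℝ c (g i) ≤ 0 := by
    by_contra! hpos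
    set b := a i - A + 2 * ‖c‖ ^ 2 - 2 * inner ℝ c (g i)
    have hN : 0 ≤ ‖c - g i‖ ^ 2 := by positivity
    have h1 := key (min 1 (b / (2 * (‖c - g i‖ ^ 2 + 1)))) (by positivity) (min_le_left _ _)
    have h2 : min 1 (b / (2 * (‖c - g i‖ ^ 2 + 1))) * ‖c - g i‖ ^ 2 ≤
        b / (2 * (‖c - g i‖ ^ 2 + 1)) * ‖c - g i‖ ^ 2 :=
      mul_le_mul_of_nonneg_right (min_le_right _ _) hN
    have h3 : b / (2 * (‖c - g i‖ ^ 2 + 1)) * ‖c - g i‖ ^ 2 < b := by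
      rw [div_mul_eq_mul_div, div_lt_iff₀ (by positivity)]
      nlinarith
    linarith
  refine (pow_le_pow_iff_left₀ (norm_nonneg _) (norm_nonneg _) two_ne_zero).1 ?_
  rw [norm_sub_sq_real]
  simp only [ha] at key0
  linarith

/-- Closed balls are weak-* compact after identifying `Y` with its dual, so the finite case passes
to arbitrary families by the finite intersection property. -/
theorem exists_forall_norm_sub_le [CompleteSpace Y] {ι : Type*} (u : ι → X) (g : ι → Y)
    (h : ∀ i j, ‖g i - g j‖ ≤ ‖u i - u j‖) : ∃ c : Y, ∀ i, ‖c - g i‖ ≤ ‖u i‖ := by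
  classical
  rcases isEmpty_or_nonempty ι with hι | ⟨⟨i₀⟩⟩
  · exact ⟨0, fun i => hι.elim i⟩
  let T := InnerProductSpace.toDual ℝ Y
  let B : ι → Set (WeakDual ℝ Y) := fun i =>
    WeakDual.toStrongDual ⁻¹' Metric.closedBall (T (g i)) ‖u i‖
  have hB : ∀ i, IsCompact (B i) := fun i => WeakDual.isCompact_closedBall _ _
  obtain ⟨φ, -, hφ⟩ := (hB i₀).inter_iInter_nonempty B (fun i => (hB i).isClosed) (by
    intro v
    obtain ⟨c, hc⟩ := exists_forall_norm_sub_le_of_finite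
      (fun i : (insert i₀ v : Finset ι) => u i) (fun i => g i) (fun i j => h i j)
    have hmem : ∀ i ∈ insert i₀ v, StrongDual.toWeakDual (T c) ∈ B i := by
      intro i hi
      have : dist (T c) (T (g i)) ≤ ‖u i‖ := by
        rw [T.isometry.dist_eq, dist_eq_norm]
        exact hc ⟨i, hi⟩
      exact this
    refine ⟨StrongDual.toWeakDual (T c), hmem i₀ (Finset.mem_insert_self _ _), ?_⟩
    exact Set.mem_iInter₂.2 fun i hi => hmem i (Finset.mem_insert_of_mem hi))
  refine ⟨T.symm (WeakDual.toStrongDual φ), fun i => ?_⟩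
  have h1 : dist (WeakDual.toStrongDual φ) (T (g i)) ≤ ‖u i‖ := Set.mem_iInter.1 hφ i
  rw [← dist_eq_norm, ← T.isometry.dist_eq, T.apply_symm_apply]
  exact h1

/-- **Kirszbraun's theorem**: a Lipschitz map from a subset of an inner product space to a Hilbert
space extends to the whole space with the same Lipschitz constant. -/
theorem LipschitzOnWith.exists_extend_inner [CompleteSpace Y] {K : ℝ≥0} {S : Set X} {g : X → Y}
    (hg : LipschitzOnWith K g S) : ∃ G : X → Y, LipschitzWith K G ∧ Set.EqOn G g S := by
  -- Partial extensions are represented by their graphs; the inequality already forces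
  -- single-valuedness.
  let P : Set (Set (X × Y)) := {A | ∀ p ∈ A, ∀ q ∈ A, dist p.2 q.2 ≤ K * dist p.1 q.1}
  obtain ⟨M, hSM, hM⟩ := zorn_subset_nonempty P (by
    intro c hc hchain _
    refine ⟨⋃₀ c, ?_, fun s hs => Set.subset_sUnion_of_mem hs⟩
    rintro p ⟨A, hA, hpA⟩ q ⟨B, hB, hqB⟩
    rcases hchain.total hA hB with hAB | hBA
    · exact hc hB p (hAB hpA) q hqB
    · exact hc hA p hpA q (hBA hqB)) ((fun x => (x, g x)) '' S) (by
    rintro _ ⟨x, hx, rfl⟩ _ ⟨y, hy, rfl⟩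
    exact hg.dist_le_mul x hx y hy)
  have hMP : ∀ p ∈ M, ∀ q ∈ M, dist p.2 q.2 ≤ K * dist p.1 q.1 := hM.prop
  have hdom : ∀ x, ∃ y, (x, y) ∈ M := by
    intro x
    obtain ⟨c, hc⟩ := exists_forall_norm_sub_le
      (fun p : M => (K : ℝ) • (x - p.1.1)) (fun p : M => p.1.2) (by
        intro p q
        have := hMP p.1 p.2 q.1 q.2
        rw [← smul_sub, sub_sub_sub_cancel_left, norm_smul, ← dist_eq_norm, ← dist_eq_norm,
          Real.norm_of_nonneg K.coe_nonneg, dist_comm q.1.1]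
        exact this)
    have hc' : ∀ p ∈ M, dist c p.2 ≤ K * dist x p.1 := by
      intro p hp
      have := hc ⟨p, hp⟩
      rwa [norm_smul, ← dist_eq_norm, ← dist_eq_norm, Real.norm_of_nonneg K.coe_nonneg] at this
    have hins : insert (x, c) M ∈ P := by
      rintro p (rfl | hp) q (rfl | hq)
      · simp
      · exact hc' q hq
      · rw [dist_comm, dist_comm p.1]; exact hc' p hp
      · exact hMP p hp q hq
    exact ⟨c, hM.le_of_ge hins (Set.subset_insert _ _) (Set.mem_insert _ _)⟩
  choose G hG using hdom
  refine ⟨G, LipschitzWith.of_dist_le_mul fun x y => hMP _ (hG x) _ (hG y), fun x hx => ?_⟩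
  have := hMP _ (hG x) _ (hSM ⟨x, hx, rfl⟩)
  exact dist_le_zero.1 (by simpa using this)

end Kirszbraun

/-! ### Uniformly continuous selection by Chebyshev centres -/

/-- Approximate Chebyshev centres of convex sets of bounded diameter depend uniformly
continuously on the set, with respect to the Hausdorff distance. -/
theorem exists_selection_of_convex_of_dist_le {H : Type*} [NormedAddCommGroup H]
    [InnerProductSpace ℝ H] {D η : ℝ} (hD : 0 ≤ D) (hη : 0 < η) :
    ∃ h > 0, ∃ c : Set H → H, ∀ A : Set H, Convex ℝ A → A.Nonempty →
      (∀ a ∈ A, ∀ b ∈ A, dist a b ≤ D) → c A ∈ A ∧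
      ∀ B : Set H, Convex ℝ B → B.Nonempty → (∀ a ∈ B, ∀ b ∈ B, dist a b ≤ D) →
        (∀ a ∈ A, ∃ b ∈ B, dist a b ≤ h) → (∀ b ∈ B, ∃ a ∈ A, dist b a ≤ h) →
        dist (c A) (c B) ≤ η := by
  classical
  -- The parallelogram law below gives `dist (c A) p ^ 2 ≤ 4 * (r + 6 * h) ^ 2 - 4 * (r ^ 2 - 2 * h
  -- * r) = 56 * h * r + 144 * h ^ 2` with `r = r A ≤ D`.
  obtain ⟨h, hh, hη2, hh1, hhη⟩ : ∃ h : ℝ, 0 < h ∧ h ≤ η / 2 ∧ h ≤ 1 ∧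
      h * (56 * D + 144) ≤ (η / 2) ^ 2 := by
    refine ⟨min (η / 2) (min 1 ((η / 2) ^ 2 / (56 * D + 144))), by positivity, min_le_left _ _,
      (min_le_right _ _).trans (min_le_left _ _), ?_⟩
    rw [← le_div_iff₀ (by positivity)]
    exact (min_le_right _ _).trans (min_le_right _ _)
  let S : Set H → Set ℝ := fun A => {ρ | 0 ≤ ρ ∧ ∃ c ∈ A, ∀ a ∈ A, dist a c ≤ ρ}
  let r : Set H → ℝ := fun A => sInf (S A)
  have hbdd : ∀ A, BddBelow (S A) := fun A => ⟨0, fun ρ hρ => hρ.1⟩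
  have hDS : ∀ A : Set H, A.Nonempty → (∀ a ∈ A, ∀ b ∈ A, dist a b ≤ D) → D ∈ S A :=
    fun A ⟨a, ha⟩ hA => ⟨hD, a, ha, fun b hb => hA b hb a ha⟩
  have hex : ∀ A : Set H, ∃ c : H, A.Nonempty → (∀ a ∈ A, ∀ b ∈ A, dist a b ≤ D) →
      c ∈ A ∧ ∀ a ∈ A, dist a c ≤ r A + h := by
    intro A
    by_cases hA : A.Nonempty ∧ ∀ a ∈ A, ∀ b ∈ A, dist a b ≤ D
    · obtain ⟨ρ, ⟨-, c, hcA, hc⟩, hρ⟩ := exists_lt_of_csInf_lt ⟨D, hDS A hA.1 hA.2⟩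
        (show sInf (S A) < r A + h from lt_add_of_pos_right _ hh)
      exact ⟨c, fun _ _ => ⟨hcA, fun a ha => (hc a ha).trans hρ.le⟩⟩
    · exact ⟨0, fun h1 h2 => (hA ⟨h1, h2⟩).elim⟩
  choose c hc using hex
  refine ⟨h, hh, c, fun A hAc hAn hAD => ⟨(hc A hAn hAD).1, fun B _ hBn hBD hAB hBA => ?_⟩⟩
  obtain ⟨hcA, hcA'⟩ := hc A hAn hAD
  obtain ⟨hcB, hcB'⟩ := hc B hBn hBD
  have hr0 : 0 ≤ r A := Real.sInf_nonneg fun ρ hρ => hρ.1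
  have hrD : r A ≤ D := csInf_le (hbdd A) (hDS A hAn hAD)
  obtain ⟨b₀, hb₀, hcb₀⟩ := hAB _ hcA
  have hrB : r B ≤ r A + 3 * h := by
    refine csInf_le (hbdd B) ⟨by positivity, b₀, hb₀, fun b hb => ?_⟩
    obtain ⟨a, ha, hab⟩ := hBA b hb
    have := dist_triangle4 b a (c A) b₀
    have := hcA' a ha
    linarith
  obtain ⟨p, hp, hcp⟩ := hBA _ hcB
  have hpA : ∀ a ∈ A, dist a p ≤ r A + 6 * h := by
    intro a ha
    obtain ⟨b, hb, hab⟩ := hAB a ha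
    have := dist_triangle4 a b (c B) p
    have := hcB' b hb
    linarith
  -- Both `c A` and `p` are nearly optimal centres of `A`. Their midpoint lies in `A` by convexity
  -- and cannot beat the radius `r A`, so the two must be close.
  obtain ⟨a, ha, ham⟩ : ∃ a ∈ A, r A - h ≤ dist a (midpoint ℝ (c A) p) := by
    by_contra! hcon
    have hm : midpoint ℝ (c A) p ∈ A := hAc.midpoint_mem hcA hp
    have h0 : 0 ≤ r A - h := dist_nonneg.trans (hcon _ hm).le
    have : r A ≤ r A - h := csInf_le (hbdd A) ⟨h0, _, hm, fun a ha => (hcon a ha).le⟩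
    linarith
  have hpar : dist a (midpoint ℝ (c A) p) ^ 2 =
      dist a (c A) ^ 2 / 2 + dist a p ^ 2 / 2 - dist (c A) p ^ 2 / 4 := by
    have e1 : a - midpoint ℝ (c A) p = (1 / 2 : ℝ) • ((a - c A) + (a - p)) := by
      rw [midpoint_eq_smul_add, invOf_eq_inv]; module
    have e2 : c A - p = (a - p) - (a - c A) := by abel
    rw [dist_eq_norm, dist_eq_norm, dist_eq_norm, dist_eq_norm, e1, e2, norm_smul, mul_pow,
      norm_add_sq_real, norm_sub_sq_real (a - p), real_inner_comm (a - c A)]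
    norm_num
    ring
  have h1 : dist a (c A) ^ 2 ≤ (r A + 6 * h) ^ 2 :=
    pow_le_pow_left₀ dist_nonneg ((hcA' a ha).trans (by linarith)) 2
  have h2 : dist a p ^ 2 ≤ (r A + 6 * h) ^ 2 := pow_le_pow_left₀ dist_nonneg (hpA a ha) 2
  have h3 : r A ^ 2 - 2 * h * r A ≤ dist a (midpoint ℝ (c A) p) ^ 2 := by
    rcases le_total (r A) h with hle | hle
    · nlinarith [sq_nonneg (dist a (midpoint ℝ (c A) p))]
    · have := pow_le_pow_left₀ (sub_nonneg.2 hle) ham 2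
      nlinarith
  have h4 : dist (c A) p ^ 2 ≤ (η / 2) ^ 2 := by
    have : h * r A ≤ h * D := mul_le_mul_of_nonneg_left hrD hh.le
    have : h * h ≤ h * 1 := mul_le_mul_of_nonneg_left hh1 hh.le
    nlinarith
  have h5 : dist (c A) p ≤ η / 2 := (pow_le_pow_iff_left₀ dist_nonneg (by positivity) two_ne_zero).1 h4
  have := dist_triangle (c A) p (c B)
  rw [dist_comm p] at this
  linarith

/-! ### Lipschitz approximation of maps with small oscillation -/

/-- On a convex set, control at scale `δ` gives control of Lipschitz type at all larger scales. -/
theorem Convex.dist_le_of_forall_dist_le {X H : Type*} [NormedAddCommGroup X] [NormedSpace ℝ X]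
    [PseudoMetricSpace H] {X₁ : Set X} (hX₁ : Convex ℝ X₁) {g : X₁ → H} {δ η : ℝ}
    (hδ : 0 < δ) (hη : 0 ≤ η) (hg : ∀ x x', dist x x' ≤ δ → dist (g x) (g x') ≤ η) (x x' : X₁) :
    dist (g x) (g x') ≤ η * (dist x x' / δ + 1) := by
  set n := ⌈dist x x' / δ⌉₊ with hn
  rcases Nat.eq_zero_or_pos n with hn0 | hn0
  · have h0 : dist x x' / δ ≤ 0 := Nat.ceil_eq_zero.1 hn0
    have h1 : dist x x' ≤ 0 := by
      by_contra! hpos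
      exact absurd h0 (not_le.2 (div_pos hpos hδ))
    have h2 := hg x x' (h1.trans hδ.le)
    have h3 : 0 ≤ dist x x' / δ := by positivity
    nlinarith
  have hnR : (0 : ℝ) < n := Nat.cast_pos.2 hn0
  -- Truncation at `1` keeps the subdivision points in `X₁` for every `k`, not only for `k ≤ n`.
  have hmem : ∀ k : ℕ, AffineMap.lineMap (x : X) (x' : X) (min (k / n : ℝ) 1) ∈ X₁ := fun k =>
    hX₁.lineMap_mem x.2 x'.2 ⟨by positivity, min_le_right _ _⟩
  let p : ℕ → X₁ := fun k => ⟨_, hmem k⟩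
  have hp0 : p 0 = x := Subtype.ext (by simp [p])
  have hpn : p n = x' := Subtype.ext (by simp [p, hnR.ne'])
  have hstep : ∀ {k}, k < n → dist (g (p k)) (g (p (k + 1))) ≤ η := by
    intro k hk
    refine hg _ _ ?_
    have hk1 : (k + 1 : ℝ) ≤ n := by exact_mod_cast hk
    have e1 : min (k / n : ℝ) 1 = k / n := min_eq_left ((div_le_one hnR).2 (by linarith))
    have e2 : min ((k + 1 : ℕ) / n : ℝ) 1 = (k + 1) / n := by
      push_cast; exact min_eq_left ((div_le_one hnR).2 hk1)
    have e3 : dist (k / n : ℝ) ((k + 1) / n) = 1 / n := by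
      rw [Real.dist_eq, ← sub_div, sub_add_cancel_left, neg_div, abs_neg, abs_of_pos (by positivity)]
    rw [Subtype.dist_eq]
    simp only [p]
    rw [dist_lineMap_lineMap, e1, e2, e3, ← Subtype.dist_eq, one_div_mul_eq_div, div_le_iff₀ hnR,
      mul_comm, ← div_le_iff₀ hδ]
    exact Nat.le_ceil _
  have hsum := dist_le_range_sum_of_dist_le (f := fun k => g (p k)) n (d := fun _ => η) hstep
  rw [hp0, hpn, Finset.sum_const, Finset.card_range, nsmul_eq_mul] at hsum
  have hceil : (n : ℝ) < dist x x' / δ + 1 := Nat.ceil_lt_add_one (by positivity)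
  nlinarith

/-- A map from a convex subset of an inner product space to a Hilbert space which oscillates by at
most `η` at scale `δ` is within `3 * η` of a Lipschitz map. -/
theorem Convex.exists_lipschitzWith_dist_le {X H : Type*} [NormedAddCommGroup X]
    [InnerProductSpace ℝ X] [NormedAddCommGroup H] [InnerProductSpace ℝ H] [CompleteSpace H]
    {X₁ : Set X} (hX₁ : Convex ℝ X₁) {g : X₁ → H} {δ η : ℝ}
    (hδ : 0 < δ) (hη : 0 ≤ η) (hg : ∀ x x', dist x x' ≤ δ → dist (g x) (g x') ≤ η) :
    ∃ (K : ℝ≥0) (G : X₁ → H), LipschitzWith K G ∧ ∀ x, dist (G x) (g x) ≤ 3 * η := by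
  -- A maximal `δ`-separated set: separation makes `g` Lipschitz on it, maximality makes it a
  -- `δ`-net.
  obtain ⟨N, hN⟩ := zorn_subset {N : Set X₁ | N.Pairwise fun x y => δ < dist x y} (by
    intro c hc hchain
    refine ⟨⋃₀ c, ?_, fun s hs => Set.subset_sUnion_of_mem hs⟩
    exact (Set.pairwise_sUnion hchain.directedOn).2 fun s hs => hc hs)
  have hNp : N.Pairwise fun x y => δ < dist x y := hN.prop
  have hcover : ∀ x, ∃ s ∈ N, dist x s ≤ δ := by
    intro x
    by_contra! hcon
    have hins : (insert x N).Pairwise fun x y => δ < dist x y :=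
      hNp.insert fun y hy _ => ⟨hcon y hy, dist_comm x y ▸ hcon y hy⟩
    have hx : x ∈ N := hN.le_of_ge hins (Set.subset_insert _ _) (Set.mem_insert _ _)
    have := hcon x hx
    rw [dist_self] at this
    linarith
  -- For distinct net points `dist x y / δ ≥ 1`, so `η * (dist x y / δ + 1)` is at most `2 * η / δ *
  -- dist x y`.
  let K : ℝ≥0 := ⟨2 * η / δ, by positivity⟩
  have hK : (K : ℝ) = 2 * η / δ := rfl
  have hext : ∀ x : X₁, Function.extend Subtype.val g 0 (x : X) = g x := fun x =>
    Subtype.val_injective.extend_apply g 0 x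
  have hlip : LipschitzOnWith K (Function.extend Subtype.val g 0) (Subtype.val '' N) := by
    refine LipschitzOnWith.of_dist_le_mul ?_
    rintro _ ⟨x, hx, rfl⟩ _ ⟨y, hy, rfl⟩
    rw [hext, hext, hK]
    rcases eq_or_ne x y with rfl | hxy
    · simp
    have h1 := hX₁.dist_le_of_forall_dist_le hδ hη hg x y
    have h2 : 1 ≤ dist x y / δ := (one_le_div hδ).2 (hNp hx hy hxy).le
    rw [← Subtype.dist_eq, show 2 * η / δ * dist x y = η * (2 * (dist x y / δ)) by ring]
    exact h1.trans (mul_le_mul_of_nonneg_left (by linarith) hη)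
  obtain ⟨G, hG, hGeq⟩ := hlip.exists_extend_inner
  refine ⟨K, fun x => G x, fun x y => hG x y, fun x => ?_⟩
  obtain ⟨s, hs, hxs⟩ := hcover x
  have h1 : dist (G x) (G s) ≤ 2 * η := by
    refine (hG.dist_le_mul _ _).trans ?_
    rw [hK, ← Subtype.dist_eq, div_mul_eq_mul_div, div_le_iff₀ hδ]
    exact mul_le_mul_of_nonneg_left hxs (by linarith)
  have h2 : G s = g s := (hGeq ⟨s, hs, rfl⟩).trans (hext s)
  have h3 := dist_triangle (G x) (G s) (g x)
  have h4 := hg s x (dist_comm x s ▸ hxs)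
  rw [← h2] at h4
  linarith

/-! ### Fibres of the surjection and selections inside them -/

/-- `L` restricted to the orthogonal complement of its kernel is bijective, and the bounded inverse
theorem makes its inverse continuous. -/
theorem ContinuousLinearMap.exists_rightInverse_of_surjective_of_complete {H Y : Type*}
    [NormedAddCommGroup H] [InnerProductSpace ℝ H] [CompleteSpace H] [NormedAddCommGroup Y]
    [NormedSpace ℝ Y] [CompleteSpace Y] (L : H →L[ℝ] Y) (hL : Function.Surjective L) :
    ∃ R : Y →L[ℝ] H, ∀ y, L (R y) = y := by
  have hcl : IsClosed (L.ker : Set H) := L.isClosed_ker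
  have : CompleteSpace L.ker := hcl.completeSpace_coe
  let V := L.kerᗮ
  let e : V →L[ℝ] Y := L.comp V.subtypeL
  have hinj : e.ker = ⊥ := by
    rw [Submodule.eq_bot_iff]
    rintro ⟨v, hv⟩ hev
    have : v ∈ L.ker := hev
    exact Subtype.ext (inner_self_eq_zero (𝕜 := ℝ).1 (hv v this))
  have hsurj : e.range = ⊤ := by
    rw [LinearMap.range_eq_top]
    intro y
    obtain ⟨x, rfl⟩ := hL y
    obtain ⟨u, hu, v, hv, rfl⟩ := L.ker.exists_add_mem_mem_orthogonal x
    refine ⟨⟨v, hv⟩, ?_⟩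
    have : L u = 0 := hu
    simp [e, this]
  let E := ContinuousLinearEquiv.ofBijective e hinj hsurj
  exact ⟨V.subtypeL.comp E.symm.toContinuousLinearMap, fun y => E.apply_symm_apply y⟩

/-- The intersection of a fattened uniformly continuous family of convex sets with the fibres of a
continuous linear surjection over a Lipschitz map is uniformly continuous. -/
theorem exists_dist_le_of_fattened_fiber {X H Y : Type*} [PseudoMetricSpace X]
    [NormedAddCommGroup H] [NormedSpace ℝ H] [NormedAddCommGroup Y] [NormedSpace ℝ Y]
    {L : H →L[ℝ] Y} {R : Y →L[ℝ] H} (hR : ∀ y, L (R y) = y) {F : X → Set H}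
    (hFc : ∀ x, Convex ℝ (F x)) {D : ℝ} (hD : 0 ≤ D) (hFD : ∀ x, ∀ a ∈ F x, ∀ b ∈ F x, dist a b ≤ D)
    (hF : ∀ h > 0, ∃ δ > 0, ∀ x x', dist x x' ≤ δ → ∀ z ∈ F x, ∃ z' ∈ F x', dist z z' ≤ h)
    {f : X → Y} {K : ℝ≥0} (hf : LipschitzWith K f) (hfF : ∀ x, f x ∈ L '' F x)
    {ρ h : ℝ} (hρ : 0 < ρ) (hh : 0 < h) :
    ∃ δ > 0, ∀ x x', dist x x' ≤ δ → ∀ y, L y = f x → (∃ z ∈ F x, dist y z ≤ ρ) →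
      ∃ y', (L y' = f x' ∧ ∃ z ∈ F x', dist y' z ≤ ρ) ∧ dist y y' ≤ h := by
  -- The total displacement below is at most `t * (ρ + 2 * h₁ + D) + h₁ ≤ 3 * h₁ + 2 * h₁ / ρ * D`,
  -- which this choice makes equal to `h`.
  set h₁ : ℝ := h / (3 + 2 * D / ρ) with hh₁
  have hh₁0 : 0 < h₁ := by positivity
  have hh₁e : h₁ * (3 + 2 * D / ρ) = h := div_mul_cancel₀ _ (by positivity)
  obtain ⟨δ, hδ, hFδ⟩ := hF h₁ hh₁0
  refine ⟨min δ (h₁ / (‖R‖ * K + 1)), by positivity, fun x x' hxx y hLy ⟨z, hz, hyz⟩ => ?_⟩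
  obtain ⟨z', hz', hzz⟩ := hFδ x x' (hxx.trans (min_le_left _ _)) z hz
  obtain ⟨y₀, hy₀, hLy₀⟩ := hfF x'
  -- Adding `v` moves `y` into the fibre over `f x'`, at the price of a distance up to `ρ + 2 * h₁`
  -- from `F x'`.
  set v : H := R (f x' - f x) with hv
  have hvn : ‖v‖ ≤ h₁ := by
    have h1 : ‖f x' - f x‖ ≤ K * dist x x' := by
      rw [← dist_eq_norm, dist_comm]; exact hf.dist_le_mul x x'
    have h2 : dist x x' * (‖R‖ * K + 1) ≤ h₁ :=
      (le_div_iff₀ (by positivity)).1 (hxx.trans (min_le_right _ _))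
    have h3 : ‖R‖ * ‖f x' - f x‖ ≤ ‖R‖ * (K * dist x x') :=
      mul_le_mul_of_nonneg_left h1 (norm_nonneg _)
    have h4 := R.le_opNorm (f x' - f x)
    have h5 : 0 ≤ dist x x' := dist_nonneg
    linarith
  have hLv : L (y + v) = f x' := by simp [hv, hR, hLy]
  have hyz' : ‖y + v - z'‖ ≤ ρ + 2 * h₁ := by
    have e : y + v - z' = (y - z) + (z - z') + v := by abel
    rw [dist_eq_norm] at hyz hzz
    have := norm_add₃_le (a := y - z) (b := z - z') (c := v)
    rw [e]; linarith
  have hpos : 0 < ρ + 2 * h₁ := by positivity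
  -- Chosen so that `(1 - t) * (ρ + 2 * h₁) = ρ`: contracting towards `y₀`, which lies both in `F
  -- x'` and in the fibre, restores the distance `ρ`.
  set t : ℝ := 2 * h₁ / (ρ + 2 * h₁) with ht
  have ht0 : 0 ≤ t := by positivity
  have ht1 : t * (ρ + 2 * h₁) = 2 * h₁ := div_mul_cancel₀ _ hpos.ne'
  have ht2 : t ≤ 1 := (div_le_one hpos).2 (by linarith)
  have htρ : t ≤ 2 * h₁ / ρ := div_le_div_of_nonneg_left (by positivity) hρ (by linarith)
  refine ⟨(1 - t) • (y + v) + t • y₀, ⟨?_, (1 - t) • z' + t • y₀,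
    hFc x' hz' hy₀ (by linarith) ht0 (by ring), ?_⟩, ?_⟩
  · rw [map_add, map_smul, map_smul, hLv, hLy₀, ← add_smul, sub_add_cancel, one_smul]
  · rw [dist_add_right, dist_eq_norm, ← smul_sub, norm_smul, Real.norm_of_nonneg (by linarith)]
    have := mul_le_mul_of_nonneg_left hyz' (show 0 ≤ 1 - t by linarith)
    nlinarith
  · have e : y - ((1 - t) • (y + v) + t • y₀) = t • ((y + v - z') + (z' - y₀)) - v := by module
    have h1 : ‖(y + v - z') + (z' - y₀)‖ ≤ ρ + 2 * h₁ + D := by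
      refine (norm_add_le _ _).trans (add_le_add hyz' ?_)
      rw [← dist_eq_norm]; exact hFD x' z' hz' y₀ hy₀
    have h2 : ‖t • ((y + v - z') + (z' - y₀))‖ ≤ t * (ρ + 2 * h₁ + D) := by
      rw [norm_smul, Real.norm_of_nonneg ht0]
      exact mul_le_mul_of_nonneg_left h1 ht0
    have h3 : t * D ≤ 2 * h₁ / ρ * D := mul_le_mul_of_nonneg_right htρ hD
    have h4 : h₁ * (3 + 2 * D / ρ) = 3 * h₁ + 2 * h₁ / ρ * D := by ring
    rw [dist_eq_norm, e]
    have := norm_sub_le (t • ((y + v - z') + (z' - y₀))) v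
    linarith

/-- A uniformly continuous family of convex sets of uniformly bounded diameter in a Hilbert space
has Lipschitz approximate selections with prescribed Lipschitz image under a continuous linear
surjection. -/
theorem exists_lipschitzWith_approx_selection {X H Y : Type*} [NormedAddCommGroup X]
    [InnerProductSpace ℝ X] [NormedAddCommGroup H] [InnerProductSpace ℝ H] [CompleteSpace H]
    [NormedAddCommGroup Y] [NormedSpace ℝ Y] [CompleteSpace Y] {X₁ : Set X} (hX₁ : Convex ℝ X₁)
    {L : H →L[ℝ] Y} (hL : Function.Surjective L) {F : X₁ → Set H}
    (hFc : ∀ x, Convex ℝ (F x)) {D : ℝ} (hD : 0 ≤ D) (hFD : ∀ x, ∀ a ∈ F x, ∀ b ∈ F x, dist a b ≤ D)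
    (hF : ∀ h > 0, ∃ δ > 0, ∀ x x', dist x x' ≤ δ → ∀ z ∈ F x, ∃ z' ∈ F x', dist z z' ≤ h)
    {f : X₁ → Y} {K : ℝ≥0} (hf : LipschitzWith K f) (hfF : ∀ x, f x ∈ L '' F x)
    {ε : ℝ} (hε : 0 < ε) :
    ∃ (C : ℝ≥0) (g : X₁ → H), LipschitzWith C g ∧ (∀ x, L (g x) = f x) ∧
      ∀ x, ∃ z ∈ F x, dist (g x) z ≤ ε := by
  obtain ⟨R, hR⟩ := L.exists_rightInverse_of_surjective_of_complete hL
  set ρ := ε / 2 with hρ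
  have hρ0 : 0 < ρ := by positivity
  let G : X₁ → Set H := fun x => {y | L y = f x ∧ ∃ z ∈ F x, dist y z ≤ ρ}
  have hGc : ∀ x, Convex ℝ (G x) := by
    rintro x y ⟨hy, z, hz, hyz⟩ y' ⟨hy', z', hz', hyz'⟩ a b ha hb hab
    refine ⟨?_, a • z + b • z', hFc x hz hz' ha hb hab, ?_⟩
    · rw [map_add, map_smul, map_smul, hy, hy', ← add_smul, hab, one_smul]
    · refine (dist_add_add_le _ _ _ _).trans ?_
      rw [dist_smul₀, dist_smul₀, Real.norm_of_nonneg ha, Real.norm_of_nonneg hb]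
      have := mul_le_mul_of_nonneg_left hyz ha
      have := mul_le_mul_of_nonneg_left hyz' hb
      calc _ ≤ a * ρ + b * ρ := by linarith
        _ = ρ := by rw [← add_mul, hab, one_mul]
  have hGn : ∀ x, (G x).Nonempty := fun x => by
    obtain ⟨y, hy, hLy⟩ := hfF x
    exact ⟨y, hLy, y, hy, by rw [dist_self]; exact hρ0.le⟩
  have hGD : ∀ x, ∀ a ∈ G x, ∀ b ∈ G x, dist a b ≤ D + 2 * ρ := by
    rintro x a ⟨-, z, hz, haz⟩ b ⟨-, z', hz', hbz⟩
    have := dist_triangle4 a z z' b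
    have := hFD x z hz z' hz'
    rw [dist_comm z'] at *
    linarith
  -- Correcting by `R` turns an error `3 * η` into at most `3 * η * M = ρ`; with the fattening `ρ`
  -- this makes `ε`.
  set M := 1 + ‖R‖ * ‖L‖ with hM
  have hM0 : 0 < M := by positivity
  set η := ρ / (3 * M) with hη
  have hη0 : 0 < η := by positivity
  obtain ⟨h, hh, c, hc⟩ := exists_selection_of_convex_of_dist_le
    (H := H) (show 0 ≤ D + 2 * ρ by positivity) hη0
  obtain ⟨δ, hδ, hGδ⟩ := exists_dist_le_of_fattened_fiber hR hFc hD hFD hF hf hfF hρ0 hh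
  have hcG : ∀ x, c (G x) ∈ G x := fun x => (hc _ (hGc x) (hGn x) (hGD x)).1
  obtain ⟨C, g, hg, hgc⟩ := hX₁.exists_lipschitzWith_dist_le (g := fun x => c (G x)) hδ hη0.le
    (fun x x' hxx => (hc _ (hGc x) (hGn x) (hGD x)).2 _ (hGc x') (hGn x') (hGD x')
      (fun a ha => hGδ x x' hxx a ha.1 ha.2)
      (fun a ha => hGδ x' x (dist_comm x x' ▸ hxx) a ha.1 ha.2))
  refine ⟨_, fun x => g x - R (L (g x) - f x),
    hg.sub (R.lipschitz.comp ((L.lipschitz.comp hg).sub hf)), fun x => by simp [hR], fun x => ?_⟩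
  obtain ⟨hLc, z, hz, hcz⟩ := hcG x
  refine ⟨z, hz, ?_⟩
  have h1 : ‖g x - c (G x)‖ ≤ 3 * η := by rw [← dist_eq_norm]; exact hgc x
  have h2 : ‖R (L (g x) - f x)‖ ≤ ‖R‖ * ‖L‖ * ‖g x - c (G x)‖ := by
    rw [← hLc, ← map_sub, mul_assoc]
    exact (R.le_opNorm _).trans (mul_le_mul_of_nonneg_left (L.le_opNorm _) (norm_nonneg _))
  have h3 : ‖g x - c (G x)‖ * M ≤ 3 * η * M := mul_le_mul_of_nonneg_right h1 hM0.le
  have h4 : 3 * η * M = ρ := by rw [hη]; field_simp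
  have h5 := norm_sub_le (g x - c (G x)) (R (L (g x) - f x))
  have h6 : g x - R (L (g x) - f x) - z =
      (g x - c (G x) - R (L (g x) - f x)) + (c (G x) - z) := by abel
  rw [dist_eq_norm] at hcz
  rw [dist_eq_norm, h6]
  have := norm_add_le (g x - c (G x) - R (L (g x) - f x)) (c (G x) - z)
  have : ‖g x - c (G x)‖ * M = ‖g x - c (G x)‖ + ‖R‖ * ‖L‖ * ‖g x - c (G x)‖ := by rw [hM]; ring
  linarith

/-! ### Application to the pair of set-valued mappings -/

theorem UniformlyContinuousWithModulus.exists_forall_dist_le {X Y : Type*} [MetricSpace X]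
    [PseudoMetricSpace Y] {F : X → Set Y} {ω : ℝ≥0 → ℝ≥0}
    (hF : UniformlyContinuousWithModulus F ω) {h : ℝ} (hh : 0 < h) :
    ∃ δ > 0, ∀ x x', dist x x' ≤ δ → ∀ z ∈ F x, ∃ z' ∈ F x', dist z z' ≤ h := by
  have hω : ∀ᶠ t in 𝓝[>] (0 : ℝ≥0), ω t < h.toNNReal :=
    hF.1.eventually (gt_mem_nhds (Real.toNNReal_pos.2 hh))
  obtain ⟨δ, hδ, hωδ⟩ := (mem_nhdsGT_iff_exists_Ioc_subset).1 hω
  refine ⟨δ, hδ, fun x x' hxx z hz => ?_⟩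
  -- The limit of `ω` at `0+` says nothing about `ω 0`, so coinciding points are treated separately.
  rcases eq_or_ne x x' with rfl | hne
  · exact ⟨z, hz, by rw [dist_self]; exact hh.le⟩
  · have h1 : ω (nndist x x') < h.toNNReal :=
      hωδ ⟨pos_iff_ne_zero.2 (nndist_eq_zero.not.2 hne), hxx⟩
    obtain ⟨z', hz', hzz⟩ := Metric.exists_edist_lt_of_hausdorffEDist_lt hz
      ((hF.2 x x').trans_lt (ENNReal.coe_lt_coe.2 h1))
    exact ⟨z', hz', (edist_le_ofReal hh.le).1 hzz.le⟩

theorem theorem3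
    {X Y Y₁ Y₂ : Type*}
    [NormedAddCommGroup X] [InnerProductSpace ℝ X] [CompleteSpace X]
    [NormedAddCommGroup Y] [InnerProductSpace ℝ Y] [CompleteSpace Y]
    [NormedAddCommGroup Y₁] [InnerProductSpace ℝ Y₁] [CompleteSpace Y₁]
    [NormedAddCommGroup Y₂] [InnerProductSpace ℝ Y₂] [CompleteSpace Y₂]
    (X₁ : Set X) (hX₁ : Convex ℝ X₁)
    (L : WithLp 2 (Y₁ × Y₂) →L[ℝ] Y) (hL : Function.Surjective L)
    (F₁ : X₁ → Set Y₁) (F₂ : X₁ → Set Y₂) (ω₁ ω₂ : ℝ≥0 → ℝ≥0)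
    (hF₁ : UniformlyContinuousWithModulus F₁ ω₁)
    (hF₂ : UniformlyContinuousWithModulus F₂ ω₂)
    (hF₁_img : ∀ x, Convex ℝ (F₁ x) ∧ IsClosed (F₁ x) ∧ Bornology.IsBounded (F₁ x))
    (hF₂_img : ∀ x, Convex ℝ (F₂ x) ∧ IsClosed (F₂ x) ∧ Bornology.IsBounded (F₂ x))
    (hd : (⨆ x : X₁, Metric.ediam (pairSet (F₁ x) (F₂ x))) < ⊤)
    (f : X₁ → Y) (hf : ∃ K : ℝ≥0, LipschitzWith K f)
    (hf_sel : ∀ x, f x ∈ L '' pairSet (F₁ x) (F₂ x))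
    (ε : ℝ) (hε : 0 < ε) :
    ∃ (f₁ : X₁ → Y₁) (f₂ : X₁ → Y₂),
      (∃ K₁ : ℝ≥0, LipschitzWith K₁ f₁) ∧
      (∃ K₂ : ℝ≥0, LipschitzWith K₂ f₂) ∧
      (∀ x, f₁ x ∈ F₁ x + Metric.closedBall 0 ε) ∧
      (∀ x, f₂ x ∈ F₂ x + Metric.closedBall 0 ε) ∧
      (∀ x, f x = L (WithLp.toLp 2 (f₁ x, f₂ x))) := by
  obtain ⟨K, hf⟩ := hf
  set D := ⨆ x : X₁, Metric.ediam (pairSet (F₁ x) (F₂ x)) with hDdef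
  have hFc : ∀ x, Convex ℝ (pairSet (F₁ x) (F₂ x)) := fun x z hz w hw a b ha hb hab =>
    ⟨(hF₁_img x).1 hz.1 hw.1 ha hb hab, (hF₂_img x).1 hz.2 hw.2 ha hb hab⟩
  have hFD : ∀ x, ∀ a ∈ pairSet (F₁ x) (F₂ x), ∀ b ∈ pairSet (F₁ x) (F₂ x),
      dist a b ≤ D.toReal := by
    intro x a ha b hb
    have h1 : edist a b ≤ D := (Metric.edist_le_ediam_of_mem ha hb).trans
      (le_iSup (fun x : X₁ => Metric.ediam (pairSet (F₁ x) (F₂ x))) x)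
    rw [dist_edist]
    exact ENNReal.toReal_mono hd.ne h1
  have hF : ∀ h > 0, ∃ δ > 0, ∀ x x' : X₁, dist x x' ≤ δ → ∀ z ∈ pairSet (F₁ x) (F₂ x),
      ∃ z' ∈ pairSet (F₁ x') (F₂ x'), dist z z' ≤ h := by
    intro h hh
    -- Half of `h` in each coordinate suffices, since `(h / 2) ^ 2 + (h / 2) ^ 2 ≤ h ^ 2`.
    obtain ⟨δ₁, hδ₁, h₁⟩ := hF₁.exists_forall_dist_le (half_pos hh)
    obtain ⟨δ₂, hδ₂, h₂⟩ := hF₂.exists_forall_dist_le (half_pos hh)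
    refine ⟨min δ₁ δ₂, lt_min hδ₁ hδ₂, fun x x' hxx z hz => ?_⟩
    obtain ⟨a, ha, hza⟩ := h₁ x x' (hxx.trans (min_le_left _ _)) _ hz.1
    obtain ⟨b, hb, hzb⟩ := h₂ x x' (hxx.trans (min_le_right _ _)) _ hz.2
    refine ⟨WithLp.toLp 2 (a, b), ⟨ha, hb⟩, ?_⟩
    rw [WithLp.prod_dist_eq_of_L2]
    refine Real.sqrt_le_iff.2 ⟨hh.le, ?_⟩
    have e1 := pow_le_pow_left₀ dist_nonneg hza 2
    have e2 := pow_le_pow_left₀ dist_nonneg hzb 2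
    change dist z.fst a ^ 2 + dist z.snd b ^ 2 ≤ h ^ 2
    nlinarith
  obtain ⟨C, g, hg, hLg, hgF⟩ := exists_lipschitzWith_approx_selection hX₁ hL hFc
    ENNReal.toReal_nonneg hFD hF hf hf_sel hε
  refine ⟨fun x => (g x).fst, fun x => (g x).snd, ⟨C, fun x y => ?_⟩, ⟨C, fun x y => ?_⟩,
    fun x => ?_, fun x => ?_, fun x => (hLg x).symm⟩
  · exact (WithLp.edist_fst_le _ _).trans (hg x y)
  · exact (WithLp.edist_snd_le _ _).trans (hg x y)
  · obtain ⟨z, hz, hgz⟩ := hgF x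
    refine Set.mem_add.2 ⟨z.fst, hz.1, (g x).fst - z.fst, ?_, by abel⟩
    rw [mem_closedBall_zero_iff, ← dist_eq_norm]
    exact (WithLp.dist_fst_le _ _).trans hgz
  · obtain ⟨z, hz, hgz⟩ := hgF x
    refine Set.mem_add.2 ⟨z.snd, hz.2, (g x).snd - z.snd, ?_, by abel⟩
    rw [mem_closedBall_zero_iff, ← dist_eq_norm]
    exact (WithLp.dist_snd_le _ _).trans hgz
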